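/- Let $F_0=0$, $F_1=1$, $F_m=F_{m-1}+F_{m-2}$ for $m\ge 2$ be the Fibonacci numbers. A Rogers–Ramanujan partition is a partition in which any two consecutive parts differ by at least $2$. A string in a Rogers–Ramanujan partition is a maximal sequence of consecutive parts in which the difference between consecutive parts is at most $3$; every Rogers–Ramanujan partition decomposes into strings, any two of which are separated by a gap of at least $4$. For a string $\psi$ let $\eta=\eta(\psi)$ be the number of gaps between consecutive parts of $\psi$ that are equal to $3$, and define its weight by $$\omega_6(\psi)=\begin{cases}F_{\eta+3}, & \text{if all parts of }\psi\text{ are}\ge 3,\\ F_{\eta+2}, & \text{if either } 1\in\psi,\ 3\notin\psi \text{ and } 4\notin\psi,\ \text{or } 2\in\psi,\\ F_{\eta+1}, & \text{if } 1\in\psi \text{ and either } 3\in\psi \text{ or } 4\in\psi.\end{cases}$$ Define the weight of a Rogers–Ramanujan partition $\tilde\pi$ as $\omega_6(\tilde\pi)=\prod_{\psi}\omega_6(\psi)$, the product being over all strings $\psi$ of $\tilde\pi$ (so the empty partition has weight $1$). Theorem. For every integer $n\ge 0$, let $A_{7,2}(n)$ be the number of partitions of $n$ into parts $\not\equiv 0,\pm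 2 \pmod 7$. Then $$A_{7,2}(n)=\sum_{\tilde\pi}\omega_6(\tilde\pi),$$ where the sum is over all Rogers–Ramanujan partitions $\tilde\pi$ of $n$. -/

import Mathlib

namespace RRWeighted

/-- The parts of a partition, listed in increasing order (with multiplicity). -/
def sortedParts {n : ℕ} (p : n.Partition) : List ℕ :=
  p.parts.sort (· ≤ ·)

/-- A Rogers–Ramanujan partition: any two consecutive parts differ by at least `2`. -/
def IsRogersRamanujan {n : ℕ} (p : n.Partition) : Prop :=
  (sortedParts p).IsChain (fun a b => a + 2 ≤ b)

instance {n : ℕ} (p : n.Partition) : Decidable (IsRogersRamanujan p) := by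
  unfold IsRogersRamanujan
  infer_instance

/-- The strings of a partition: the maximal blocks of consecutive parts in which the difference
between consecutive parts is at most `3`. (`List.splitBy` cuts the increasing list of parts exactly
at the places where two adjacent parts differ by at least `4`.) -/
def strings {n : ℕ} (p : n.Partition) : List (List ℕ) :=
  (sortedParts p).splitBy (fun a b => decide (b ≤ a + 3))

/-- `gapsThree ψ` is the number `η(ψ)` of gaps equal to `3` between consecutive parts
of the (increasing) string `ψ`. -/
def gapsThree (ψ : List ℕ) : ℕ :=
  (ψ.zip ψ.tail).countP (fun ab => decide (ab.2 = ab.1 + 3))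

/-- The weight of a string `ψ` with `η` gaps equal to `3`. Parts are positive and `1`, `2` are not
both parts of a Rogers–Ramanujan partition, so the last case is the case where `1 ∈ ψ` and
either `3 ∈ ψ` or `4 ∈ ψ`. -/
def stringWeight (ψ : List ℕ) : ℕ :=
  if ∀ a ∈ ψ, 3 ≤ a then Nat.fib (gapsThree ψ + 3)
  else if (1 ∈ ψ ∧ 3 ∉ ψ ∧ 4 ∉ ψ) ∨ 2 ∈ ψ then Nat.fib (gapsThree ψ + 2)
  else Nat.fib (gapsThree ψ + 1)

/-- The weight of a partition: the product of the weights of its strings. -/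
def weight {n : ℕ} (p : n.Partition) : ℕ :=
  ((strings p).map stringWeight).prod

end RRWeighted

namespace RRWeighted

open PowerSeries PowerSeries.WithPiTopology Filter Topology Finset

/-! ### Divisibility by powers of `X` and limits -/

/-! Both sides have generating function D(0,1), where D(A,B) is the sum of
q^((k+j)²+j²+Ak+Bj)/((q)_k (q)_j) over k, j ≥ 0.

Product side (`doubleSeries_mul_qFactorialInf`, `partialTripleProd_congr`): this is an
Andrews–Gordon identity modulo 7. Specializations of (q)_∞ D and an explicit family of alternating
series solve the same three recurrences with the same limits, so they agree. The member of the
family that equals (q)_∞ D(0,1) is, by Jacobi's triple product, the product over the residues 0, ±2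
modulo 7; dividing by (q)_∞ leaves the allowed parts.

Partition side (`rrSeries_listWeight`, `weightedSeries_zero`): read a partition from its smallest
part upwards, carrying an index c. A gap 2 keeps c, a gap 3 raises it by one, and a longer gap pays
F_c and restarts at c = 3. The cases of the weight become the starting values c = 3, 2, 1 for
smallest part ≥ 3, = 2, = 1. Weights satisfy the Fibonacci recurrence in c, so c = 3 reduces to c =
1 and c = 2, and F_1 = F_2 = 1 closes the system on two families: H_m = S_{m+1} + q^(m+1) H_{m+2}
and S_m = S_{m+1} + q^(m+1) S_{m+2} + q^(m+2) H_{m+3}. D(m,m+1) and D(m,m) satisfy it too. All four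
tend to 1, which determines the solution. -/

theorem eq_zero_of_forall_X_pow_dvd {f : ℤ⟦X⟧} (h : ∀ d, X ^ d ∣ f) : f = 0 := by
  ext n
  simpa using X_pow_dvd_iff.1 (h (n + 1)) n (Nat.lt_succ_self n)

theorem X_pow_dvd_of_tendsto {ι : Type*} {l : Filter ι} [l.NeBot] {d : ℕ} {f : ι → ℤ⟦X⟧}
    {g c : ℤ⟦X⟧} (h : Tendsto f l (𝓝 g)) (hf : ∀ᶠ i in l, X ^ d ∣ f i - c) : X ^ d ∣ g - c := by
  rw [X_pow_dvd_iff]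
  intro m hm
  have h1 := (tendsto_iff_coeff_tendsto ℤ _ _ _).1 h m
  have h2 : Tendsto (fun i => coeff m (f i)) l (𝓝 (coeff m c)) := by
    refine tendsto_const_nhds.congr' ?_
    filter_upwards [hf] with i hi
    have := X_pow_dvd_iff.1 hi m hm
    rw [map_sub, sub_eq_zero] at this
    exact this.symm
  rw [map_sub, tendsto_nhds_unique h1 h2, sub_self]

theorem X_pow_dvd_tsum {ι : Type*} {d : ℕ} {f : ι → ℤ⟦X⟧} (h : ∀ i, X ^ d ∣ f i) :
    X ^ d ∣ ∑' i, f i := by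
  by_cases hf : Summable f
  · have := X_pow_dvd_of_tendsto (d := d) (c := 0) hf.hasSum
      (Eventually.of_forall fun s => by
        rw [sub_zero]; exact Finset.dvd_sum fun i _ => h i)
    simpa using this
  · rw [tsum_eq_zero_of_not_summable hf]
    exact dvd_zero _

theorem summable_of_X_pow_dvd {ι : Type*} {f : ι → ℤ⟦X⟧} (s : ι → ℕ)
    (hs : ∀ n, {i | s i ≤ n}.Finite) (h : ∀ i, X ^ s i ∣ f i) : Summable f := by
  rw [summable_iff_summable_coeff]
  intro n
  refine summable_of_hasFiniteSupport ((hs n).subset fun i hi => ?_)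
  rw [Function.mem_support] at hi
  by_contra hlt
  exact hi (X_pow_dvd_iff.1 (h i) n (not_le.1 hlt))

theorem summable_nat_of_X_pow_dvd {f : ℕ → ℤ⟦X⟧} (h : ∀ i, X ^ i ∣ f i) : Summable f :=
  summable_of_X_pow_dvd id (fun n => Set.finite_Iic n) h

theorem X_pow_dvd_tsum_sub {ι : Type*} [DecidableEq ι] {d : ℕ} {f : ι → ℤ⟦X⟧} (hf : Summable f)
    (i₀ : ι) (h : ∀ i, i ≠ i₀ → X ^ d ∣ f i) : X ^ d ∣ ∑' i, f i - f i₀ := by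
  rw [hf.tsum_eq_add_tsum_ite i₀, add_sub_cancel_left]
  refine X_pow_dvd_tsum fun i => ?_
  split_ifs with hi
  · exact dvd_zero _
  · exact h i hi

/-! ### `q`-factorials -/

/-- The `q`-factorial `(q; q)_n`, with `q = X`. -/
noncomputable def qFactorial (n : ℕ) : ℤ⟦X⟧ := ∏ i ∈ range n, (1 - X ^ (i + 1))

theorem qFactorial_zero : qFactorial 0 = 1 := by simp [qFactorial]

theorem qFactorial_succ (n : ℕ) : qFactorial (n + 1) = qFactorial n * (1 - X ^ (n + 1)) :=
  prod_range_succ _ _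

theorem constantCoeff_qFactorial (n : ℕ) : constantCoeff (qFactorial n) = 1 := by
  simp [qFactorial, map_prod]

/-- The inverse of the `q`-factorial. -/
noncomputable def qFactorialInv (n : ℕ) : ℤ⟦X⟧ := invOfUnit (qFactorial n) 1

theorem qFactorial_mul_inv (n : ℕ) : qFactorial n * qFactorialInv n = 1 :=
  mul_invOfUnit _ _ (by simp [constantCoeff_qFactorial])

theorem qFactorialInv_zero : qFactorialInv 0 = 1 := by
  simpa [qFactorial_zero] using qFactorial_mul_inv 0

theorem one_sub_mul_qFactorialInv_succ (n : ℕ) :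
    (1 - X ^ (n + 1)) * qFactorialInv (n + 1) = qFactorialInv n := by
  have h1 := qFactorial_mul_inv (n + 1)
  rw [qFactorial_succ] at h1
  have h2 := qFactorial_mul_inv n
  linear_combination qFactorialInv n * h1 - (1 - X ^ (n + 1)) * qFactorialInv (n + 1) * h2

/-- The infinite product `(q; q)_∞`. -/
noncomputable def qFactorialInf : ℤ⟦X⟧ := ∏' i, (1 - X ^ (i + 1))

theorem X_pow_dvd_qFactorial_sub {d n : ℕ} (h : d ≤ n) :
    X ^ d ∣ qFactorial n - qFactorial d := by
  induction n, h using Nat.le_induction with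
  | base => simp
  | succ n hn ih =>
    rw [qFactorial_succ]
    have : X ^ d ∣ qFactorial n * X ^ (n + 1) :=
      Dvd.dvd.mul_left (pow_dvd_pow _ (by omega)) _
    convert dvd_sub ih this using 1
    ring

theorem X_pow_dvd_qFactorialInf_sub (d : ℕ) : X ^ d ∣ qFactorialInf - qFactorial d :=
  X_pow_dvd_of_tendsto (multipliable_one_sub_X_pow ℤ).hasProd.tendsto_prod_nat
    ((eventually_ge_atTop d).mono fun _ => X_pow_dvd_qFactorial_sub)

/-! ### The double series -/

/-- The general term of `doubleSeries`. -/
noncomputable def doubleTerm (A B : ℕ) (p : ℕ × ℕ) : ℤ⟦X⟧ :=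
  X ^ ((p.1 + p.2) ^ 2 + p.2 ^ 2 + A * p.1 + B * p.2) * (qFactorialInv p.1 * qFactorialInv p.2)

/-- The series `∑ q^((k+j)² + j² + A k + B j) / ((q)_k (q)_j)` over all `k, j ≥ 0`. -/
noncomputable def doubleSeries (A B : ℕ) : ℤ⟦X⟧ := ∑' p, doubleTerm A B p

theorem summable_doubleTerm (A B : ℕ) : Summable (doubleTerm A B) := by
  refine summable_of_X_pow_dvd (fun p => p.1 + p.2) (fun n => ?_) fun p =>
    Dvd.dvd.mul_right (pow_dvd_pow _ ((Nat.le_self_pow two_ne_zero (p.1 + p.2)).trans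
      (by simp only [add_assoc]; exact Nat.le_add_right _ _))) _
  refine ((Set.finite_Iic n).prod (Set.finite_Iic n)).subset fun p hp => ?_
  simp only [Set.mem_ofPred_eq, Set.mem_prod, Set.mem_Iic] at hp ⊢
  omega

/-- The difference puts a factor 1 - q^k on each term. It kills k = 0 and cancels the last factor of
(q)_k, so k can be shifted by one. -/
theorem doubleSeries_sub_left (A B : ℕ) :
    doubleSeries A B - doubleSeries (A + 1) B = X ^ (A + 1) * doubleSeries (A + 2) (B + 2) := by
  rw [doubleSeries, doubleSeries, doubleSeries,
    ← (summable_doubleTerm A B).tsum_sub (summable_doubleTerm (A + 1) B),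
    ← (summable_doubleTerm (A + 2) (B + 2)).tsum_mul_left]
  have hinj : Function.Injective fun p : ℕ × ℕ => (p.1 + 1, p.2) := by
    rintro ⟨a, b⟩ ⟨c, d⟩ h
    simpa using h
  rw [← hinj.tsum_eq]
  · refine tsum_congr fun ⟨k, j⟩ => ?_
    simp only [doubleTerm]
    rw [← one_sub_mul_qFactorialInv_succ k]
    ring
  · rintro ⟨k, j⟩ h
    rcases k with _ | k
    · simp [doubleTerm] at h
    · exact ⟨(k, j), rfl⟩

theorem doubleSeries_sub_right (A B : ℕ) :
    doubleSeries A B - doubleSeries A (B + 1) = X ^ (B + 2) * doubleSeries (A + 2) (B + 4) := by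
  rw [doubleSeries, doubleSeries, doubleSeries,
    ← (summable_doubleTerm A B).tsum_sub (summable_doubleTerm A (B + 1)),
    ← (summable_doubleTerm (A + 2) (B + 4)).tsum_mul_left]
  have hinj : Function.Injective fun p : ℕ × ℕ => (p.1, p.2 + 1) := by
    rintro ⟨a, b⟩ ⟨c, d⟩ h
    simpa using h
  rw [← hinj.tsum_eq]
  · refine tsum_congr fun ⟨k, j⟩ => ?_
    simp only [doubleTerm]
    rw [← one_sub_mul_qFactorialInv_succ j]
    ring
  · rintro ⟨k, j⟩ h
    rcases j with _ | j
    · simp [doubleTerm] at h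
    · exact ⟨(k, j), rfl⟩

theorem X_pow_dvd_doubleSeries_sub_one {A B d : ℕ} (hA : d ≤ A) (hB : d ≤ B) :
    X ^ d ∣ doubleSeries A B - 1 := by
  have := X_pow_dvd_tsum_sub (d := d) (summable_doubleTerm A B) (0, 0) fun p hp => ?_
  · simpa [doubleSeries, doubleTerm, qFactorialInv_zero] using this
  · refine Dvd.dvd.mul_right (pow_dvd_pow _ ?_) _
    obtain ⟨k, j⟩ := p
    have : 1 ≤ k ∨ 1 ≤ j := by
      by_contra h
      apply hp
      ext <;> simp <;> omega
    simp only
    rcases this with h | h <;> nlinarith [Nat.zero_le ((k + j) ^ 2), Nat.zero_le (A * k), Nat.zero_le (B * j)]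

/-! ### The alternating series -/

/-- `(-1)^n q^(3nm + n(7n+1)/2) (q^(n+1); q)_m`. -/
noncomputable def altCoeff (m n : ℕ) : ℤ⟦X⟧ :=
  (-1) ^ n * X ^ (3 * n * m + ∑ i ∈ range n, (7 * i + 4)) *
    ∏ l ∈ range m, (1 - X ^ (n + l + 1))

/-- The alternating series solving the recurrences of Andrews and Gordon modulo `7`. -/
noncomputable def altSeries (i m : ℕ) : ℤ⟦X⟧ :=
  ∑' n, altCoeff m n * X ^ ((3 - i) * n) * (1 - X ^ (i * (m + 1 + 2 * n)))

theorem le_sum_range (n : ℕ) : n ≤ ∑ i ∈ range n, (7 * i + 4) := by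
  simpa using Finset.card_nsmul_le_sum (range n) (fun i => 7 * i + 4) 1 (fun i _ => by omega)

theorem X_pow_dvd_altCoeff (m n : ℕ) : X ^ (n + 3 * n * m) ∣ altCoeff m n := by
  refine Dvd.dvd.mul_right (Dvd.dvd.mul_left (pow_dvd_pow _ ?_) _) _
  have := le_sum_range n
  omega

theorem summable_altSeries (i m : ℕ) :
    Summable fun n => altCoeff m n * X ^ ((3 - i) * n) * (1 - X ^ (i * (m + 1 + 2 * n)) : ℤ⟦X⟧) :=
  summable_nat_of_X_pow_dvd fun n => Dvd.dvd.mul_right (Dvd.dvd.mul_right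
    ((pow_dvd_pow _ (by omega)).trans (X_pow_dvd_altCoeff m n)) _) _

theorem altCoeff_mul_succ (m n : ℕ) :
    altCoeff m n * (1 - X ^ (n + m + 1)) * X ^ (3 * n) = altCoeff (m + 1) n := by
  rw [altCoeff, altCoeff, prod_range_succ]
  ring

theorem one_sub_mul_altCoeff_succ (m n : ℕ) :
    (1 - X ^ (n + 1)) * altCoeff m (n + 1) =
      - altCoeff (m + 1) n * X ^ (4 * n + 3 * m + 4) := by
  rw [altCoeff, altCoeff, prod_range_succ', sum_range_succ]
  have : ∀ l, (1 - X ^ (n + 1 + l + 1) : ℤ⟦X⟧) = 1 - X ^ (n + (l + 1) + 1) := fun l => by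
    congr 2; omega
  simp only [this]
  ring

/-- The factor 1 - X^n kills the term n = 0 of the `g` part, which is then shifted by one and merged
with `h`. -/
theorem tsum_sub_tsum_of_shift {u v g h w : ℕ → ℤ⟦X⟧} (hu : Summable u) (hv : Summable v)
    (hh : Summable h) (huv : ∀ n, u n - v n = (1 - X ^ n) * g n + h n)
    (hw : ∀ n, (1 - X ^ (n + 1)) * g (n + 1) + h n = w n) : ∑' n, u n - ∑' n, v n = ∑' n, w n := by
  have huv' : Summable fun n => (1 - X ^ n) * g n := by
    refine ((hu.sub hv).sub hh).congr fun n => ?_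
    rw [huv]; ring
  rw [← hu.tsum_sub hv, tsum_congr huv, huv'.tsum_add hh, huv'.tsum_eq_zero_add]
  simp only [pow_zero, sub_self, zero_mul, zero_add]
  rw [← ((summable_nat_add_iff 1).2 huv').tsum_add hh]
  exact tsum_congr hw

theorem altSeries_sub_altSeries {i m : ℕ} (hi : i < 3) :
    altSeries (i + 1) m - altSeries i m = X ^ ((m + 1) * i) * altSeries (3 - i) (m + 1) := by
  rw [altSeries, altSeries, altSeries, ← (summable_altSeries _ _).tsum_mul_left]
  -- With L = m + 1 + 2n, the splitting is 1 - q^((i+1)L) - q^n (1 - q^(iL)) = (1 - q^n) + q^(n+iL)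
  -- (1 - q^(n+m+1)).
  refine tsum_sub_tsum_of_shift (g := fun n => altCoeff m n * X ^ ((2 - i) * n))
    (h := fun n => X ^ ((m + 1) * i) * (altCoeff (m + 1) n * X ^ (i * n)))
    (summable_altSeries _ _) (summable_altSeries _ _) ?_ (fun n => ?_) (fun n => ?_)
  · refine (summable_nat_of_X_pow_dvd fun n => ?_).mul_left _
    exact Dvd.dvd.mul_right ((pow_dvd_pow _ (by omega)).trans (X_pow_dvd_altCoeff _ n)) _
  · rw [← altCoeff_mul_succ]
    interval_cases i <;> ring
  · have h := one_sub_mul_altCoeff_succ m n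
    interval_cases i
    · simp only [Nat.sub_zero, Nat.sub_self]
      linear_combination X ^ (2 * (n + 1)) * h
    · simp only [Nat.add_one_sub_one, Nat.reduceSub]
      linear_combination X ^ (1 * (n + 1)) * h
    · simp only [Nat.sub_self, Nat.reduceSub]
      linear_combination X ^ (0 * (n + 1)) * h

theorem altSeries_zero (m : ℕ) : altSeries 0 m = 0 := by
  simp [altSeries]

theorem X_pow_dvd_altSeries_sub {i m : ℕ} (hi : 1 ≤ i) (d : ℕ) (hd : d ≤ m) :
    X ^ d ∣ altSeries i m - qFactorial d := by
  have h1 := X_pow_dvd_tsum_sub (d := d) (summable_altSeries i m) 0 fun n hn => ?_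
  · have h2 : altCoeff m 0 = qFactorial m := by simp [altCoeff, qFactorial]
    rw [← altSeries] at h1
    have h3 : (X ^ d : ℤ⟦X⟧) ∣ qFactorial m * X ^ (i * (m + 1)) :=
      Dvd.dvd.mul_left (pow_dvd_pow _ (by nlinarith)) _
    convert dvd_sub (dvd_add h1 (X_pow_dvd_qFactorial_sub hd)) h3 using 1
    simp only [h2, mul_zero, pow_zero, mul_one, add_zero]
    ring
  · refine Dvd.dvd.mul_right (Dvd.dvd.mul_right
      ((pow_dvd_pow _ ?_).trans (X_pow_dvd_altCoeff m n)) _) _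
    have : 1 ≤ n := Nat.one_le_iff_ne_zero.2 hn
    nlinarith

/-- The system of recurrences of Andrews and Gordon modulo `7` has at most one solution with given
limits. -/
theorem gordon_unique {D₁ D₂ D₃ : ℕ → ℤ⟦X⟧} (h₁ : ∀ m, D₁ m = D₃ (m + 1))
    (h₂ : ∀ m, D₂ m = D₁ m + X ^ (m + 1) * D₂ (m + 1))
    (h₃ : ∀ m, D₃ m = D₂ m + X ^ (2 * m + 2) * D₁ (m + 1))
    (hd : ∀ d, X ^ d ∣ D₁ d ∧ X ^ d ∣ D₂ d ∧ X ^ d ∣ D₃ d) : D₂ 0 = 0 := by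
  refine eq_zero_of_forall_X_pow_dvd fun d => ?_
  -- Divisibility by X^d descends from index m + 1 to m, for D₁, D₂, D₃ in this order.
  have key : ∀ k m, m + k = d → X ^ d ∣ D₁ m ∧ X ^ d ∣ D₂ m ∧ X ^ d ∣ D₃ m := by
    intro k
    induction k with
    | zero => rintro m rfl; exact hd m
    | succ k ih =>
      intro m hm
      obtain ⟨i₁, i₂, i₃⟩ := ih (m + 1) (by omega)
      have j₁ : X ^ d ∣ D₁ m := h₁ m ▸ i₃
      have j₂ : X ^ d ∣ D₂ m := h₂ m ▸ dvd_add j₁ (i₂.mul_left _)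
      exact ⟨j₁, j₂, h₃ m ▸ dvd_add j₂ (i₁.mul_left _)⟩
  exact (key d 0 (by omega)).2.1

theorem doubleSeries_mul_qFactorialInf : doubleSeries 0 1 * qFactorialInf = altSeries 2 0 := by
  have lim : ∀ {A B i d : ℕ}, d ≤ A → d ≤ B → 1 ≤ i →
      X ^ d ∣ doubleSeries A B * qFactorialInf - altSeries i d := by
    intro A B i d hA hB hi
    have h1 := (X_pow_dvd_doubleSeries_sub_one hA hB).mul_right qFactorialInf
    convert dvd_sub (dvd_add h1 (X_pow_dvd_qFactorialInf_sub d))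
      (X_pow_dvd_altSeries_sub hi d le_rfl) using 1
    ring
  rw [← sub_eq_zero]
  refine gordon_unique
    (D₁ := fun m => doubleSeries (m + 1) (2 * m + 2) * qFactorialInf - altSeries 1 m)
    (D₂ := fun m => doubleSeries m (2 * m + 1) * qFactorialInf - altSeries 2 m)
    (D₃ := fun m => doubleSeries m (2 * m) * qFactorialInf - altSeries 3 m)
    (fun m => ?_) (fun m => ?_) (fun m => ?_)
    fun d => ⟨lim (by omega) (by omega) (by omega), lim (by omega) (by omega) (by omega),
      lim (by omega) (by omega) (by omega)⟩
  · have := altSeries_sub_altSeries (i := 0) (m := m) (by omega)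
    rw [altSeries_zero, mul_zero, pow_zero, one_mul, sub_zero] at this
    rw [this]
    ring_nf
  · have := altSeries_sub_altSeries (i := 1) (m := m) (by omega)
    -- Lowering both parameters leaves two correction terms, which `e3` recombines into X^(m+1)
    -- D(m+1, 2m+3).
    have e1 := doubleSeries_sub_left m (2 * m + 1)
    have e2 := doubleSeries_sub_right (m + 1) (2 * m + 1)
    have e3 := doubleSeries_sub_left (m + 1) (2 * m + 3)
    simp only [mul_one, Nat.add_assoc, Nat.reduceAdd, Nat.reduceSub, mul_add] at this e1 e2 e3 ⊢
    linear_combination qFactorialInf * (e1 + e2 - X ^ (m + 1) * e3) - this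
  · have := altSeries_sub_altSeries (i := 2) (m := m) (by omega)
    have e1 := doubleSeries_sub_right m (2 * m)
    simp only [mul_one, Nat.add_assoc, Nat.reduceAdd, Nat.reduceSub, mul_add] at this e1 ⊢
    linear_combination qFactorialInf * e1 - this

/-! ### Jacobi's triple product from a finite identity -/

section TripleProduct

variable {R : Type*} [CommRing R]

/-- The `q`-binomial coefficient `[2N+1, N-n]`, defined by the recurrence that follows from
applying Pascal's rule twice. -/
def tripleCoeff (Q : R) : ℕ → ℕ → R
  | 0, n => if n = 0 then 1 else 0
  | N + 1, n => (1 + Q ^ (2 * N + 2)) * tripleCoeff Q N n +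
      Q ^ (N + 1 - n) * tripleCoeff Q N (n - 1) + Q ^ (N + n + 2) * tripleCoeff Q N (n + 1)

/-- The general term of the theta series in Jacobi's triple product. -/
def thetaTerm (z w : R) (n : ℕ) : R :=
  (-1) ^ n * (z * w) ^ (∑ i ∈ range n, i) * w ^ n * (1 - z ^ (2 * n + 1))

theorem tripleCoeff_eq_zero (Q : R) {N n : ℕ} (h : N < n) : tripleCoeff Q N n = 0 := by
  induction N generalizing n with
  | zero => simp [tripleCoeff, h.ne']
  | succ N ih =>
    rw [tripleCoeff, ih (by omega), ih (by omega), ih (by omega)]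
    ring

/-- The theta term folds together the indices n and -1-n, so its value at -1 is its value at 0;
truncated subtraction in n - 1 is therefore correct at n = 0. -/
theorem thetaTerm_step (z w : R) {N n : ℕ} (h : n ≤ N) :
    (1 - z * (z * w) ^ (N + 1)) * (1 - w * (z * w) ^ N) * thetaTerm z w n =
      (1 + (z * w) ^ (2 * N + 2)) * thetaTerm z w n +
      (z * w) ^ (N - n) * thetaTerm z w (n + 1) +
      (z * w) ^ (N + n + 1) * thetaTerm z w (n - 1) := by
  obtain ⟨M, rfl⟩ := Nat.exists_eq_add_of_le h
  rw [Nat.add_sub_cancel_left]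
  rcases n with _ | n
  · simp only [thetaTerm, Nat.zero_sub, range_zero, sum_empty, zero_add, sum_range_one]
    ring
  · simp only [thetaTerm, sum_range_succ, Nat.add_sub_cancel]
    ring

/-- A finite form of Jacobi's triple product. -/
theorem finite_triple_product (z w : R) (N : ℕ) :
    ∑ n ∈ range (N + 1), tripleCoeff (z * w) N n * thetaTerm z w n =
      (∏ i ∈ range (N + 1), (1 - z * (z * w) ^ i)) * ∏ i ∈ range N, (1 - w * (z * w) ^ i) := by
  induction N with
  | zero => simp [tripleCoeff, thetaTerm]
  | succ N ih =>
    rw [prod_range_succ (fun i => 1 - z * (z * w) ^ i) (N + 1),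
      prod_range_succ (fun i => 1 - w * (z * w) ^ i) N, mul_mul_mul_comm, ← ih, sum_mul]
    -- The two new factors act on theta terms by a three-term relation; reindexing moves its shifts
    -- onto the coefficients, giving their recurrence.
    have h1 : ∑ n ∈ range (N + 1 + 1),
        (1 + (z * w) ^ (2 * N + 2)) * tripleCoeff (z * w) N n * thetaTerm z w n =
        ∑ n ∈ range (N + 1),
          (1 + (z * w) ^ (2 * N + 2)) * tripleCoeff (z * w) N n * thetaTerm z w n := by
      rw [sum_range_succ, tripleCoeff_eq_zero _ (Nat.lt_succ_self N)]
      ring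
    have h2 : ∑ n ∈ range (N + 1 + 1),
          (z * w) ^ (N + 1 - n) * tripleCoeff (z * w) N (n - 1) * thetaTerm z w n =
        ∑ n ∈ range (N + 1),
          (z * w) ^ (N - n) * tripleCoeff (z * w) N n * thetaTerm z w (n + 1) +
        (z * w) ^ (N + 1) * tripleCoeff (z * w) N 0 * thetaTerm z w 0 := by
      rw [sum_range_succ']
      simp
    have h3 : ∑ n ∈ range (N + 1 + 1),
          (z * w) ^ (N + n + 2) * tripleCoeff (z * w) N (n + 1) * thetaTerm z w n +
        (z * w) ^ (N + 1) * tripleCoeff (z * w) N 0 * thetaTerm z w 0 =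
        ∑ n ∈ range (N + 1),
          (z * w) ^ (N + n + 1) * tripleCoeff (z * w) N n * thetaTerm z w (n - 1) := by
      rw [sum_range_succ' _ N, sum_range_succ, sum_range_succ,
        tripleCoeff_eq_zero _ (show N < N + 1 by omega),
        tripleCoeff_eq_zero _ (show N < N + 1 + 1 by omega)]
      simp only [mul_zero, zero_mul, add_zero, Nat.zero_sub, Nat.add_sub_cancel]
      congr 1
    simp only [tripleCoeff, add_mul _ _ (thetaTerm z w _), sum_add_distrib]
    rw [h1, h2, add_assoc, add_assoc, add_comm (_ * tripleCoeff _ _ _ * _), h3, ← sum_add_distrib,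
      ← sum_add_distrib]
    refine sum_congr rfl fun n hn => ?_
    have := thetaTerm_step z w (Nat.lt_succ_iff.1 (mem_range.1 hn))
    linear_combination -tripleCoeff (z * w) N n * this

/-- The product `(Q; Q)_n`. -/
def qProd (Q : R) (n : ℕ) : R := ∏ i ∈ range n, (1 - Q ^ (i + 1))

theorem qProd_succ (Q : R) (n : ℕ) : qProd Q (n + 1) = qProd Q n * (1 - Q ^ (n + 1)) :=
  prod_range_succ _ _

/-- The closed form of the q-binomial coefficient, cleared of denominators; it gives the limit N →
∞. -/
theorem tripleCoeff_mul_qProd (Q : R) (N : ℕ) : ∀ M n, M + n = N →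
    tripleCoeff Q N n * (qProd Q M * qProd Q (N + n + 1)) = qProd Q (2 * N + 1) := by
  induction N with
  | zero =>
    intro M n h
    obtain ⟨rfl, rfl⟩ : M = 0 ∧ n = 0 := by omega
    simp [tripleCoeff, qProd]
  | succ N ih =>
    intro M n h
    have t1 : tripleCoeff Q N n * (qProd Q M * qProd Q (N + n + 2)) =
        qProd Q (2 * N + 1) * ((1 - Q ^ M) * (1 - Q ^ (N + n + 2))) := by
      rcases M with _ | M
      · rw [tripleCoeff_eq_zero Q (by omega)]
        ring
      · rw [qProd_succ, qProd_succ, ← ih M n (by omega)]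
        ring
    have t2 : tripleCoeff Q N (n - 1) * (qProd Q M * qProd Q (N + n + 2)) =
        qProd Q (2 * N + 1) * ((1 - Q ^ (N + n + 1)) * (1 - Q ^ (N + n + 2))) := by
      rcases n with _ | n
      · obtain rfl : M = N + 1 := by omega
        rw [qProd_succ, qProd_succ, ← ih N 0 (by omega)]
        ring_nf
      · rw [qProd_succ, ← add_assoc N n 1, qProd_succ Q (N + n + 1), ← ih M n (by omega)]
        simp only [Nat.add_sub_cancel]
        ring
    have t3 : tripleCoeff Q N (n + 1) * (qProd Q M * qProd Q (N + n + 2)) =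
        qProd Q (2 * N + 1) * ((1 - Q ^ M) * (1 - Q ^ (M - 1))) := by
      rcases M with _ | _ | M
      · rw [tripleCoeff_eq_zero Q (by omega)]
        ring
      · rw [tripleCoeff_eq_zero Q (by omega)]
        ring
      · rw [qProd_succ, qProd_succ, ← ih M (n + 1) (by omega)]
        simp only [Nat.add_sub_cancel]
        ring_nf
    have hsub : N + 1 - n = M := by omega
    rw [show N + 1 + n + 1 = N + n + 2 by ring, show 2 * (N + 1) + 1 = 2 * N + 1 + 1 + 1 by ring,
      qProd_succ Q (2 * N + 1 + 1), qProd_succ Q (2 * N + 1), tripleCoeff, hsub]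
    have key : (1 + Q ^ (2 * N + 2)) * ((1 - Q ^ M) * (1 - Q ^ (N + n + 2))) +
        Q ^ M * ((1 - Q ^ (N + n + 1)) * (1 - Q ^ (N + n + 2))) +
        Q ^ (N + n + 2) * ((1 - Q ^ M) * (1 - Q ^ (M - 1))) =
        (1 - Q ^ (2 * N + 1 + 1)) * (1 - Q ^ (2 * N + 1 + 1 + 1)) := by
      rcases M with _ | M
      · obtain rfl : n = N + 1 := by omega
        ring
      · obtain rfl : N = M + n := by omega
        simp only [Nat.add_sub_cancel]
        ring
    linear_combination (1 + Q ^ (2 * N + 2)) * t1 + Q ^ M * t2 + Q ^ (N + n + 2) * t3 +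
      qProd Q (2 * N + 1) * key

end TripleProduct

/-- The partial products of `∏ (1 - q^i)` over `i ≡ 0, ±2 (mod 7)`. -/
noncomputable def partialTripleProd (N : ℕ) : ℤ⟦X⟧ :=
  ∏ i ∈ range N, ((1 - X ^ (7 * i + 2)) * (1 - X ^ (7 * i + 5)) * (1 - X ^ (7 * i + 7)))

theorem thetaTerm_eq (n : ℕ) :
    thetaTerm (X ^ 2) (X ^ 5 : ℤ⟦X⟧) n =
      altCoeff 0 n * X ^ ((3 - 2) * n) * (1 - X ^ (2 * (0 + 1 + 2 * n))) := by
  have : ∑ i ∈ range n, (7 * i + 4) = 7 * (∑ i ∈ range n, i) + 4 * n := by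
    rw [sum_add_distrib, mul_sum]
    simp [mul_comm]
  rw [thetaTerm, altCoeff, this, range_zero, prod_empty]
  ring

theorem partialTripleProd_mul (N : ℕ) :
    partialTripleProd N * (1 - X ^ (7 * N + 2)) =
      qProd (X ^ 7) N * ∑ n ∈ range (N + 1),
        tripleCoeff (X ^ 7) N n * thetaTerm (X ^ 2) (X ^ 5 : ℤ⟦X⟧) n := by
  have h := finite_triple_product (X ^ 2) (X ^ 5 : ℤ⟦X⟧) N
  rw [← pow_add] at h
  have e2 : ∀ i, (1 - X ^ 2 * (X ^ (2 + 5)) ^ i : ℤ⟦X⟧) = 1 - X ^ (7 * i + 2) := fun i => by ring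
  have e5 : ∀ i, (1 - X ^ 5 * (X ^ (2 + 5)) ^ i : ℤ⟦X⟧) = 1 - X ^ (7 * i + 5) := fun i => by ring
  have e7 : ∀ i, (1 - (X ^ 7) ^ (i + 1) : ℤ⟦X⟧) = 1 - X ^ (7 * i + 7) := fun i => by ring
  simp only [e2, e5] at h
  simp only [partialTripleProd, prod_mul_distrib, qProd, e7]
  rw [prod_range_succ] at h
  linear_combination -(∏ i ∈ range N, (1 - X ^ (7 * i + 7) : ℤ⟦X⟧)) * h

theorem qProd_X_pow_congr {d k : ℕ} (h : d ≤ k) :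
    X ^ d ∣ qProd (X ^ 7 : ℤ⟦X⟧) k - qProd (X ^ 7) d := by
  induction k, h using Nat.le_induction with
  | base => simp
  | succ n hn ih =>
    rw [qProd_succ, ← pow_mul]
    have : (X ^ d : ℤ⟦X⟧) ∣ qProd (X ^ 7) n * X ^ (7 * (n + 1)) :=
      Dvd.dvd.mul_left (pow_dvd_pow _ (by omega)) _
    convert dvd_sub ih this using 1
    ring

theorem isUnit_qProd (k : ℕ) : IsUnit (qProd (X ^ 7 : ℤ⟦X⟧) k) := by
  rw [isUnit_iff_constantCoeff]
  simp [qProd, map_prod]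

theorem qProd_mul_tripleCoeff_congr {d n N : ℕ} (hn : n < d) (hN : 2 * d ≤ N) :
    X ^ d ∣ qProd (X ^ 7) N * tripleCoeff (X ^ 7) N n - (1 : ℤ⟦X⟧) := by
  have h := tripleCoeff_mul_qProd (X ^ 7 : ℤ⟦X⟧) N (N - n) n (by omega)
  have c1 := qProd_X_pow_congr (d := d) (k := N - n) (by omega)
  have c2 := qProd_X_pow_congr (d := d) (k := N + n + 1) (by omega)
  have c3 := qProd_X_pow_congr (d := d) (k := 2 * N + 1) (by omega)
  have c4 := qProd_X_pow_congr (d := d) (k := N) (by omega)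
  -- Modulo X^d all four products equal the unit u = `qProd (X ^ 7) d`, so the closed form reads c
  -- u² = u, which is the goal times u.
  rw [← (isUnit_qProd d).dvd_mul_left]
  generalize tripleCoeff (X ^ 7 : ℤ⟦X⟧) N n = c at *
  generalize qProd (X ^ 7 : ℤ⟦X⟧) (N - n) = p1 at *
  generalize qProd (X ^ 7 : ℤ⟦X⟧) (N + n + 1) = p2 at *
  generalize qProd (X ^ 7 : ℤ⟦X⟧) (2 * N + 1) = p3 at *
  generalize qProd (X ^ 7 : ℤ⟦X⟧) d = u at *
  have := dvd_add (dvd_sub (dvd_add (c4.mul_right (u * c)) c3) (c1.mul_right (c * u)))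
    (c2.mul_right (-(c * p1)))
  convert this using 1
  linear_combination h

theorem partialTripleProd_congr {d N : ℕ} (hN : 2 * d ≤ N) :
    X ^ d ∣ partialTripleProd N - altSeries 2 0 := by
  have hdvd : ∀ n, d ≤ n → X ^ d ∣ thetaTerm (X ^ 2) (X ^ 5 : ℤ⟦X⟧) n := fun n hn => by
    rw [thetaTerm_eq]
    exact Dvd.dvd.mul_right (Dvd.dvd.mul_right
      ((pow_dvd_pow _ (by omega)).trans (X_pow_dvd_altCoeff 0 n)) _) _
  have hs : Summable (thetaTerm (X ^ 2) (X ^ 5 : ℤ⟦X⟧)) := by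
    rw [funext thetaTerm_eq]
    exact summable_altSeries 2 0
  have h1 : altSeries 2 0 = ∑' n, thetaTerm (X ^ 2) (X ^ 5 : ℤ⟦X⟧) n := by
    rw [funext thetaTerm_eq]
    rfl
  have h2 : X ^ d ∣ ∑' n, thetaTerm (X ^ 2) (X ^ 5 : ℤ⟦X⟧) (n + (N + 1)) :=
    X_pow_dvd_tsum fun n => hdvd _ (by omega)
  have h3 : X ^ d ∣ ∑ n ∈ range (N + 1), (qProd (X ^ 7) N * tripleCoeff (X ^ 7) N n - 1) *
      thetaTerm (X ^ 2) (X ^ 5 : ℤ⟦X⟧) n := by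
    refine Finset.dvd_sum fun n _ => ?_
    rcases lt_or_ge n d with h | h
    · exact (qProd_mul_tripleCoeff_congr h hN).mul_right _
    · exact (hdvd n h).mul_left _
  have h4 : X ^ d ∣ partialTripleProd N * X ^ (7 * N + 2) :=
    Dvd.dvd.mul_left (pow_dvd_pow _ (by omega)) _
  have h5 := partialTripleProd_mul N
  rw [mul_sum] at h5
  simp only [sub_mul, one_mul, sum_sub_distrib, mul_assoc] at h3
  rw [h1, ← hs.sum_add_tsum_nat_add (N + 1)]
  convert dvd_sub (dvd_add h3 h4) h2 using 1
  linear_combination h5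

/-! ### The generating function of partitions into parts `≢ 0, ±2 (mod 7)` -/

theorem prod_range_seven_mul (N : ℕ) :
    ∏ i ∈ range (7 * N), (if (i + 1) % 7 = 0 ∨ (i + 1) % 7 = 2 ∨ (i + 1) % 7 = 5
      then (1 - X ^ (i + 1) : ℤ⟦X⟧) else 1) = partialTripleProd N := by
  induction N with
  | zero => simp [partialTripleProd]
  | succ N ih =>
    rw [partialTripleProd, prod_range_succ, ← partialTripleProd, ← ih, Nat.mul_succ]
    simp only [prod_range_succ, Nat.add_assoc, Nat.mul_add_mod, Nat.reduceAdd, Nat.reduceMod]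
    simp
    ring

theorem mk_card_restricted_eq_doubleSeries :
    (PowerSeries.mk fun n => ((Nat.Partition.restricted n
      fun a => ¬(a % 7 = 0 ∨ a % 7 = 2 ∨ a % 7 = 5)).card : ℤ)) = doubleSeries 0 1 := by
  have h1 := Nat.Partition.hasProd_powerSeriesMk_card_restricted ℤ
    fun a => ¬(a % 7 = 0 ∨ a % 7 = 2 ∨ a % 7 = 5)
  have h2 := (h1.mul (multipliable_one_sub_X_pow ℤ).hasProd).tendsto_prod_nat
  -- Partial products are taken at lengths 7N, over whole periods of residues.
  have h3 := h2.comp (tendsto_id.const_mul_atTop' (show 0 < 7 by norm_num))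
  have h4 : ∀ N, ∏ i ∈ range (7 * N),
      ((if ¬((i + 1) % 7 = 0 ∨ (i + 1) % 7 = 2 ∨ (i + 1) % 7 = 5)
        then ∑' j : ℕ, (X : ℤ⟦X⟧) ^ ((i + 1) * j) else 1) * (1 - X ^ (i + 1))) =
      partialTripleProd N := fun N => by
    rw [← prod_range_seven_mul]
    refine prod_congr rfl fun i _ => ?_
    rw [ite_not]
    split_ifs
    · rw [one_mul]
    · simp_rw [pow_mul]
      exact tsum_pow_mul_one_sub_of_constantCoeff_eq_zero (by simp)
  simp only [Function.comp_def, id, h4] at h3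
  refine mul_right_cancel₀ (tprod_one_sub_X_pow_ne_zero ℤ) ?_
  refine Eq.trans ?_ doubleSeries_mul_qFactorialInf.symm
  rw [← sub_eq_zero]
  exact eq_zero_of_forall_X_pow_dvd fun d => X_pow_dvd_of_tendsto h3
    ((eventually_ge_atTop (2 * d)).mono fun _ => partialTripleProd_congr)

/-! ### Rogers–Ramanujan partitions as lists -/

theorem isChain_iff_pairwise_add_two {l : List ℕ} :
    l.IsChain (fun a b => a + 2 ≤ b) ↔ l.Pairwise (fun a b => a + 2 ≤ b) := by
  have : Trans (fun a b : ℕ => a + 2 ≤ b) (fun a b => a + 2 ≤ b) (fun a b => a + 2 ≤ b) :=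
    ⟨fun h₁ h₂ => by omega⟩
  exact List.isChain_iff_pairwise

theorem sortedParts_injective (n : ℕ) : Function.Injective (sortedParts (n := n)) := by
  intro p q h
  have := congrArg (fun l : List ℕ => (l : Multiset ℕ)) h
  simp only [sortedParts, Multiset.sort_eq] at this
  exact Nat.Partition.ext this

/-- The lists of parts of the Rogers–Ramanujan partitions of `n` with all parts at least `a`. -/
def rrLists (a n : ℕ) : Finset (List ℕ) :=
  ((univ.filter fun p : n.Partition => IsRogersRamanujan p).image sortedParts).filter
    fun l => ∀ x ∈ l, a ≤ x

theorem mem_rrLists {a n : ℕ} {l : List ℕ} :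
    l ∈ rrLists a n ↔
      l.Pairwise (fun a b => a + 2 ≤ b) ∧ (∀ x ∈ l, a ≤ x ∧ 0 < x) ∧ l.sum = n := by
  simp only [rrLists, mem_filter, mem_image, mem_univ, true_and]
  constructor
  · rintro ⟨⟨p, hp, rfl⟩, ha⟩
    refine ⟨isChain_iff_pairwise_add_two.1 hp, fun x hx => ⟨ha x hx, ?_⟩, ?_⟩
    · exact p.parts_pos ((Multiset.mem_sort _).1 hx)
    · rw [← Multiset.sum_coe, sortedParts, Multiset.sort_eq, p.parts_sum]
  · rintro ⟨hp, ha, hs⟩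
    have hsort : (l : Multiset ℕ).sort (· ≤ ·) = l := by
      refine List.Perm.eq_of_pairwise (le := (· ≤ ·)) (fun a b _ _ => le_antisymm)
        (Multiset.pairwise_sort _ _) (hp.imp fun h => by omega) ?_
      rw [← Multiset.coe_eq_coe, Multiset.sort_eq]
    refine ⟨⟨⟨(l : Multiset ℕ), fun {x} hx => (ha x (by simpa using hx)).2, by simpa using hs⟩,
      ?_, hsort⟩, fun x hx => (ha x hx).1⟩
    rw [IsRogersRamanujan, sortedParts, hsort]
    exact isChain_iff_pairwise_add_two.2 hp

theorem rrLists_eq_union {a : ℕ} (ha : 0 < a) (n : ℕ) :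
    rrLists a n = rrLists (a + 1) n ∪
      if a ≤ n then (rrLists (a + 2) (n - a)).image (List.cons a) else ∅ := by
  ext l
  rw [mem_union, mem_rrLists, mem_rrLists]
  rcases l with _ | ⟨b, t⟩
  · split_ifs <;> simp
  · rw [List.pairwise_cons, List.forall_mem_cons, List.forall_mem_cons, List.sum_cons]
    have hmem : (b :: t ∈ if a ≤ n then (rrLists (a + 2) (n - a)).image (List.cons a) else ∅) ↔
        b = a ∧ t.Pairwise (fun a b => a + 2 ≤ b) ∧ (∀ x ∈ t, a + 2 ≤ x ∧ 0 < x) ∧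
          b + t.sum = n := by
      split_ifs with h
      · simp only [mem_image, mem_rrLists, List.cons.injEq]
        constructor
        · rintro ⟨t', ⟨h1, h2, h3⟩, rfl, rfl⟩
          exact ⟨rfl, h1, h2, by omega⟩
        · rintro ⟨rfl, h1, h2, h3⟩
          exact ⟨t, ⟨h1, h2, by omega⟩, rfl, rfl⟩
      · simp only [notMem_empty, false_iff]
        rintro ⟨rfl, -, -, h3⟩
        omega
    rw [hmem]
    constructor
    · rintro ⟨⟨h1, h2⟩, ⟨⟨h3, h4⟩, h5⟩, h6⟩
      rcases h3.eq_or_lt with rfl | h3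
      · exact Or.inr ⟨rfl, h2, fun x hx => ⟨h1 x hx, (h5 x hx).2⟩, h6⟩
      · exact Or.inl ⟨⟨h1, h2⟩, ⟨⟨h3, h4⟩, fun x hx => ⟨by have := h1 x hx; omega, (h5 x hx).2⟩⟩,
          h6⟩
    · rintro (⟨⟨h1, h2⟩, ⟨⟨h3, h4⟩, h5⟩, h6⟩ | ⟨rfl, h1, h2, h3⟩)
      · exact ⟨⟨h1, h2⟩, ⟨⟨by omega, h4⟩, fun x hx => ⟨by have := h5 x hx; omega, (h5 x hx).2⟩⟩,
          h6⟩
      · exact ⟨⟨fun x hx => (h2 x hx).1, h1⟩,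
          ⟨⟨le_rfl, ha⟩, fun x hx => ⟨by have := h2 x hx; omega, (h2 x hx).2⟩⟩, h3⟩

/-- The generating function of the Rogers–Ramanujan partitions with all parts at least `a`,
counted with weight `f`. -/
noncomputable def rrSeries (a : ℕ) (f : List ℕ → ℕ) : ℤ⟦X⟧ :=
  PowerSeries.mk fun n => ∑ l ∈ rrLists a n, (f l : ℤ)

theorem rrSeries_congr {a : ℕ} {f g : List ℕ → ℕ}
    (h : ∀ l : List ℕ, l.Pairwise (fun a b => a + 2 ≤ b) → (∀ x ∈ l, a ≤ x) → f l = g l) :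
    rrSeries a f = rrSeries a g := by
  ext n
  simp only [rrSeries, coeff_mk]
  refine sum_congr rfl fun l hl => ?_
  rw [mem_rrLists] at hl
  rw [h l hl.1 fun x hx => (hl.2.1 x hx).1]

theorem rrSeries_eq_add {a : ℕ} (ha : 0 < a) (f : List ℕ → ℕ) :
    rrSeries a f = rrSeries (a + 1) f + X ^ a * rrSeries (a + 2) (fun l => f (a :: l)) := by
  ext n
  rw [map_add, coeff_X_pow_mul']
  simp only [rrSeries, coeff_mk]
  rw [rrLists_eq_union ha, sum_union]
  · congr 1
    split_ifs
    · exact sum_image fun x _ y _ h => (List.cons.inj h).2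
    · rfl
  · rw [Finset.disjoint_left]
    intro l h1 h2
    split_ifs at h2
    · obtain ⟨t, -, rfl⟩ := mem_image.1 h2
      have := ((mem_rrLists.1 h1).2.1 a List.mem_cons_self).1
      omega
    · exact notMem_empty _ h2

theorem X_pow_dvd_rrSeries_sub {d a : ℕ} (h : d ≤ a) (f : List ℕ → ℕ) :
    X ^ d ∣ rrSeries a f - (f [] : ℤ⟦X⟧) := by
  rw [X_pow_dvd_iff]
  intro n hn
  have hnil : ∀ l ∈ rrLists a n, l = [] := fun l hl => by
    rw [mem_rrLists] at hl
    refine List.eq_nil_iff_forall_not_mem.2 fun x hx => ?_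
    have h1 := (hl.2.1 x hx).1
    have h2 := List.single_le_sum (fun _ _ => Nat.zero_le _) x hx
    omega
  rw [map_sub, rrSeries, coeff_mk, ← map_natCast (C (R := ℤ)), coeff_C]
  split_ifs with h0
  · subst h0
    have : rrLists a 0 = {[]} := by
      ext l
      rw [mem_singleton]
      refine ⟨hnil l, ?_⟩
      rintro rfl
      simp [mem_rrLists]
    simp [this]
  · rw [sum_eq_zero, sub_zero]
    intro l hl
    have := (mem_rrLists.1 hl).2.2
    rw [hnil l hl] at this
    exact absurd this.symm h0

/-! ### The weight as a recursive function -/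

/-- The weight of the list `a :: l` of parts, where the first string is given the weight
`F_(η + c)` and every other string the weight `F_(η + 3)`. -/
def chainWeight : ℕ → ℕ → List ℕ → ℕ
  | c, _, [] => Nat.fib c
  | c, a, b :: l =>
    if b ≤ a + 3 then (if b = a + 3 then chainWeight (c + 1) b l else chainWeight c b l)
    else Nat.fib c * chainWeight 3 b l

/-- The weight of a list of parts in which every string has the weight `F_(η + 3)`. -/
def fullWeight : List ℕ → ℕ
  | [] => 1
  | a :: l => chainWeight 3 a l

/-- The weight of a list of parts. -/
def listWeight (l : List ℕ) : ℕ :=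
  ((l.splitBy fun a b => decide (b ≤ a + 3)).map stringWeight).prod

/-- The weight is F_(η + c) times a factor independent of c. -/
theorem chainWeight_add_two (c a : ℕ) (l : List ℕ) :
    chainWeight (c + 2) a l = chainWeight c a l + chainWeight (c + 1) a l := by
  induction l generalizing c a with
  | nil => exact Nat.fib_add_two
  | cons b l ih =>
    simp only [chainWeight]
    split_ifs
    · exact ih (c + 1) b
    · exact ih c b
    · rw [Nat.fib_add_two, add_mul]

theorem exists_splitBy_cons (r : ℕ → ℕ → Bool) (b : ℕ) (l : List ℕ) :
    ∃ ψ L, (b :: l).splitBy r = (b :: ψ) :: L ∧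
      ∀ a, r a b = true → (a :: b :: l).splitBy r = (a :: b :: ψ) :: L := by
  rcases hs : (b :: l).splitBy r with _ | ⟨χ, L⟩
  · simp at hs
  · obtain ⟨hf, hn, hc, hc'⟩ := List.splitBy_eq_iff.1 hs
    rcases χ with _ | ⟨x, ψ⟩
    · simp at hn
    · obtain ⟨rfl, rfl⟩ : b = x ∧ l = ψ ++ L.flatten := by simpa using hf
      refine ⟨ψ, L, rfl, fun a hab => List.splitBy_eq_iff.2 ⟨by simp, by simpa using hn, ?_, ?_⟩⟩
      · rw [List.forall_mem_cons] at hc ⊢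
        exact ⟨List.isChain_cons_cons.2 ⟨hab, hc.1⟩, hc.2⟩
      · rw [List.isChain_cons] at hc' ⊢
        refine ⟨fun y hy => ?_, hc'.2⟩
        obtain ⟨_, h2, h3⟩ := hc'.1 y hy
        exact ⟨by simp, h2, by rwa [List.getLast_cons (by simp)]⟩

theorem splitBy_cons_cons_of_false {r : ℕ → ℕ → Bool} {a b : ℕ} (l : List ℕ) (h : r a b = false) :
    (a :: b :: l).splitBy r = [a] :: (b :: l).splitBy r := by
  have := List.splitBy_append (r := r) (l := [a]) (m := b :: l) (by simpa using h)
  simpa [List.splitBy_of_isChain] using this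

theorem gapsThree_cons_cons (a b : ℕ) (l : List ℕ) :
    gapsThree (a :: b :: l) = gapsThree (b :: l) + if b = a + 3 then 1 else 0 := by
  simp [gapsThree, List.countP_cons]

theorem stringWeight_of_three_le {ψ : List ℕ} (h : ∀ a ∈ ψ, 3 ≤ a) :
    stringWeight ψ = Nat.fib (gapsThree ψ + 3) :=
  if_pos h

theorem mem_of_mem_splitBy {r : ℕ → ℕ → Bool} {l ψ : List ℕ} (h : ψ ∈ l.splitBy r) {x : ℕ}
    (hx : x ∈ ψ) : x ∈ l := by
  rw [← List.flatten_splitBy r l]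
  exact List.mem_flatten.2 ⟨ψ, h, hx⟩

/-- Only the parts after `a` must be at least 3: the first string's weight is replaced by F_(η + c),
so `a` may be 1 or 2. -/
theorem fib_mul_prod_eq_chainWeight (l : List ℕ) (a c : ℕ) (ψ : List ℕ) (L : List (List ℕ))
    (h : (a :: l).splitBy (fun a b => decide (b ≤ a + 3)) = ψ :: L) (hl : ∀ x ∈ l, 3 ≤ x) :
    Nat.fib (gapsThree ψ + c) * (L.map stringWeight).prod = chainWeight c a l := by
  induction l generalizing a c ψ L with
  | nil =>
    rw [List.splitBy_of_isChain (by simp) (by simp)] at h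
    obtain ⟨rfl, rfl⟩ := List.cons.inj h
    simp [gapsThree, chainWeight]
  | cons b l ih =>
    obtain ⟨χ, L', h1, h2⟩ := exists_splitBy_cons (fun a b => decide (b ≤ a + 3)) b l
    have hl' : ∀ x ∈ l, 3 ≤ x := fun x hx => hl x (List.mem_cons_of_mem _ hx)
    by_cases hab : b ≤ a + 3
    · rw [h2 a (by simpa using hab)] at h
      obtain ⟨rfl, rfl⟩ := List.cons.inj h
      rw [gapsThree_cons_cons, chainWeight, if_pos hab]
      split_ifs with h3
      · rw [← ih b (c + 1) _ _ h1 hl', add_assoc, add_comm 1 c]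
      · rw [← ih b c _ _ h1 hl', add_zero]
    · rw [splitBy_cons_cons_of_false _ (by simpa using hab), h1] at h
      obtain ⟨rfl, rfl⟩ := List.cons.inj h
      rw [chainWeight, if_neg hab, ← ih b 3 _ _ h1 hl', List.map_cons, List.prod_cons,
        stringWeight_of_three_le]
      · simp [gapsThree]
      · exact fun x hx => hl x (mem_of_mem_splitBy (h1 ▸ List.mem_cons_self) hx)

theorem listWeight_cons {a c : ℕ} {l : List ℕ} (hl : ∀ x ∈ l, 3 ≤ x)
    (h : ∀ ψ, (a :: ψ).IsChain (fun a b => b ≤ a + 3) → (∀ x ∈ ψ, x ∈ l) →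
      stringWeight (a :: ψ) = Nat.fib (gapsThree (a :: ψ) + c)) :
    listWeight (a :: l) = chainWeight c a l := by
  obtain ⟨ψ, L, h1, -⟩ := exists_splitBy_cons (fun a b => decide (b ≤ a + 3)) a l
  rw [← fib_mul_prod_eq_chainWeight l a c _ L h1 hl, listWeight, h1, List.map_cons, List.prod_cons,
    h ψ]
  · have := List.isChain_of_mem_splitBy (h1 ▸ List.mem_cons_self (a := a :: ψ) (l := L))
    simpa using this
  · intro x hx
    have := List.flatten_splitBy (fun a b => decide (b ≤ a + 3)) (a :: l)
    rw [h1, List.flatten_cons, List.cons_append, List.cons.injEq] at this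
    rw [← this.2]
    exact List.mem_append_left _ hx

theorem listWeight_eq_fullWeight {l : List ℕ} (hl : ∀ x ∈ l, 3 ≤ x) :
    listWeight l = fullWeight l := by
  rcases l with _ | ⟨a, l⟩
  · simp [listWeight, fullWeight]
  · rw [List.forall_mem_cons] at hl
    refine listWeight_cons hl.2 fun ψ _ hψ => stringWeight_of_three_le ?_
    rw [List.forall_mem_cons]
    exact ⟨hl.1, fun x hx => hl.2 x (hψ x hx)⟩

theorem listWeight_two_cons {l : List ℕ} (hl : ∀ x ∈ l, 4 ≤ x) :
    listWeight (2 :: l) = chainWeight 2 2 l := by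
  refine listWeight_cons (fun x hx => (by norm_num : 3 ≤ 4).trans (hl x hx)) fun ψ _ _ => ?_
  rw [stringWeight, if_neg, if_pos (by simp)]
  simp

/-- The exceptional string {1} has weight F_2, which equals F_1, so c = 1 covers every string
containing 1. -/
theorem listWeight_one_cons {l : List ℕ} (hl : ∀ x ∈ l, 3 ≤ x) :
    listWeight (1 :: l) = chainWeight 1 1 l := by
  refine listWeight_cons hl fun ψ hc hψ => ?_
  rw [stringWeight, if_neg (by simp)]
  rcases ψ with _ | ⟨b, ψ⟩
  · simp [gapsThree]
  · have hb : b ≤ 4 := (List.isChain_cons_cons.1 hc).1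
    have hb' : 3 ≤ b := hl b (hψ b List.mem_cons_self)
    have h2 : 2 ∉ b :: ψ := fun h => by
      have := hl 2 (hψ 2 h)
      omega
    rw [if_neg]
    rintro (⟨-, h3, h4⟩ | h)
    · obtain rfl | rfl : b = 3 ∨ b = 4 := by omega
      · simp at h3
      · simp at h4
    · exact h2 (by simpa using h)

/-! ### The generating functions of weighted partitions -/

/-- The generating function for the tails of the partitions with smallest part `a`, where the
first string has the weight `F_(η + c)`. -/
noncomputable def tailSeries (c a : ℕ) : ℤ⟦X⟧ := rrSeries (a + 2) (chainWeight c a)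

/-- The three terms correspond to a next gap of 2, of 3, and of at least 4 (or no further part). -/
theorem tailSeries_eq (c a : ℕ) :
    tailSeries c a = X ^ (a + 2) * tailSeries c (a + 2) + X ^ (a + 3) * tailSeries (c + 1) (a + 3) +
      (Nat.fib c : ℤ⟦X⟧) * rrSeries (a + 4) fullWeight := by
  have h : rrSeries (a + 4) (chainWeight c a) =
      (Nat.fib c : ℤ⟦X⟧) * rrSeries (a + 4) fullWeight := by
    rw [rrSeries_congr (g := fun l => Nat.fib c * fullWeight l)]
    · ext n
      rw [← map_natCast (C (R := ℤ)), coeff_C_mul]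
      simp [rrSeries, mul_sum]
    · rintro (_ | ⟨b, l⟩) _ hl
      · simp [chainWeight, fullWeight]
      · have := hl b List.mem_cons_self
        rw [chainWeight, if_neg (by omega), fullWeight]
  have e₁ : (fun l => chainWeight c a ((a + 2) :: l)) = chainWeight c (a + 2) := by
    ext l
    simp [chainWeight]
  have e₂ : (fun l => chainWeight c a ((a + 2 + 1) :: l)) = chainWeight (c + 1) (a + 3) := by
    ext l
    simp [chainWeight]
  rw [tailSeries, rrSeries_eq_add (by omega), rrSeries_eq_add (by omega), h, e₁, e₂, tailSeries,
    tailSeries]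
  ring

theorem tailSeries_add_two (c a : ℕ) :
    tailSeries (c + 2) a = tailSeries c a + tailSeries (c + 1) a := by
  ext n
  simp [tailSeries, rrSeries, chainWeight_add_two, sum_add_distrib]

theorem rrSeries_fullWeight {a : ℕ} (ha : 0 < a) :
    rrSeries a fullWeight = rrSeries (a + 1) fullWeight + X ^ a * tailSeries 3 a :=
  rrSeries_eq_add ha _

/-- Partitions into parts greater than `m`, with the weight of the string of `m + 1` reduced to
`F_(η + 2)`. -/
noncomputable def reducedSeries (m : ℕ) : ℤ⟦X⟧ :=
  rrSeries (m + 2) fullWeight + X ^ (m + 1) * tailSeries 2 (m + 1)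

/-- Partitions into parts greater than `m`, with the weight of the string of `m + 1` reduced to
`F_(η + 1)`, and the one of a string starting with `m + 2` to `F_(η + 2)`. -/
noncomputable def weightedSeries (m : ℕ) : ℤ⟦X⟧ :=
  reducedSeries (m + 1) + X ^ (m + 1) * tailSeries 1 (m + 1)

/-- From c = 2, a gap of 3 leads to c = 3 at no cost, and a break also restarts at 3 after paying
F_2 = 1. Hence parts from m + 3 on carry full weight. -/
theorem tailSeries_two (m : ℕ) : tailSeries 2 m = reducedSeries (m + 1) := by
  have h1 := tailSeries_eq 2 m
  have h2 := rrSeries_fullWeight (a := m + 3) (by omega)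
  simp only [Nat.fib_two, Nat.cast_one, one_mul, Nat.add_assoc, Nat.reduceAdd] at h1 h2
  simp only [reducedSeries, Nat.add_assoc, Nat.reduceAdd]
  linear_combination h1 - h2

theorem tailSeries_one (m : ℕ) : tailSeries 1 m = weightedSeries (m + 1) := by
  have h1 := tailSeries_eq 1 m
  simp only [Nat.fib_one, Nat.cast_one, one_mul, Nat.reduceAdd] at h1
  simp only [weightedSeries, reducedSeries, Nat.add_assoc, Nat.reduceAdd]
  linear_combination h1

theorem weightedSeries_eq (m : ℕ) :
    weightedSeries m = reducedSeries (m + 1) + X ^ (m + 1) * weightedSeries (m + 2) := by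
  rw [weightedSeries, tailSeries_one]

/-- The part m + 2 with c = 3 splits into c = 2, absorbed in S_{m+1}, and c = 1, giving H_{m+3}. -/
theorem reducedSeries_eq (m : ℕ) :
    reducedSeries m = reducedSeries (m + 1) + X ^ (m + 1) * reducedSeries (m + 2) +
      X ^ (m + 2) * weightedSeries (m + 3) := by
  have h1 := rrSeries_fullWeight (a := m + 2) (by omega)
  have h2 := tailSeries_add_two 1 (m + 2)
  have h3 := tailSeries_one (m + 2)
  have h4 := tailSeries_two (m + 1)
  simp only [Nat.add_assoc, Nat.reduceAdd] at h1 h2 h3 h4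
  simp only [reducedSeries, Nat.add_assoc, Nat.reduceAdd] at h4 ⊢
  linear_combination h1 + X ^ (m + 2) * (h2 + h3) + X ^ (m + 1) * h4

theorem X_pow_dvd_reducedSeries_sub_one {d m : ℕ} (h : d ≤ m) :
    X ^ d ∣ reducedSeries m - 1 := by
  have h1 := X_pow_dvd_rrSeries_sub (d := d) (a := m + 2) (by omega) fullWeight
  have h2 : (X ^ d : ℤ⟦X⟧) ∣ X ^ (m + 1) * tailSeries 2 (m + 1) :=
    Dvd.dvd.mul_right (pow_dvd_pow _ (by omega)) _
  convert dvd_add h1 h2 using 1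
  simp only [reducedSeries, fullWeight, Nat.cast_one]
  ring

theorem X_pow_dvd_weightedSeries_sub_one {d m : ℕ} (h : d ≤ m) :
    X ^ d ∣ weightedSeries m - 1 := by
  have h2 : (X ^ d : ℤ⟦X⟧) ∣ X ^ (m + 1) * tailSeries 1 (m + 1) :=
    Dvd.dvd.mul_right (pow_dvd_pow _ (by omega)) _
  convert dvd_add (X_pow_dvd_reducedSeries_sub_one (d := d) (m := m + 1) (by omega)) h2 using 1
  rw [weightedSeries]
  ring

/-- Each recurrence refers only to larger indices, so high divisibility at large m propagates down
to m = 0. -/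
theorem weighted_unique {H S : ℕ → ℤ⟦X⟧} (hH : ∀ m, H m = S (m + 1) + X ^ (m + 1) * H (m + 2))
    (hS : ∀ m, S m = S (m + 1) + X ^ (m + 1) * S (m + 2) + X ^ (m + 2) * H (m + 3))
    (hd : ∀ d m, d ≤ m → X ^ d ∣ H m ∧ X ^ d ∣ S m) : H 0 = 0 := by
  refine eq_zero_of_forall_X_pow_dvd fun d => ?_
  have key : ∀ k m, d ≤ m + k → X ^ d ∣ H m ∧ X ^ d ∣ S m := by
    intro k
    induction k with
    | zero => exact fun m hm => hd d m hm
    | succ k ih =>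
      intro m hm
      have i₁ := ih (m + 1) (by omega)
      have i₂ := ih (m + 2) (by omega)
      have i₃ := ih (m + 3) (by omega)
      exact ⟨hH m ▸ dvd_add i₁.2 (i₂.1.mul_left _),
        hS m ▸ dvd_add (dvd_add i₁.2 (i₂.2.mul_left _)) (i₃.1.mul_left _)⟩
  exact (key d 0 (by omega)).1

theorem weightedSeries_zero : weightedSeries 0 = doubleSeries 0 1 := by
  rw [← sub_eq_zero]
  refine weighted_unique (H := fun m => weightedSeries m - doubleSeries m (m + 1))
    (S := fun m => reducedSeries m - doubleSeries m m) (fun m => ?_) (fun m => ?_) fun d m h => ?_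
  · have h1 := weightedSeries_eq m
    have h2 := doubleSeries_sub_left m (m + 1)
    simp only [Nat.add_assoc, Nat.reduceAdd] at h1 h2 ⊢
    linear_combination h1 - h2
  · have h1 := reducedSeries_eq m
    have h2 := doubleSeries_sub_left m m
    have h3 := doubleSeries_sub_right (m + 1) m
    simp only [Nat.add_assoc, Nat.reduceAdd] at h1 h2 h3 ⊢
    linear_combination h1 - h2 - h3
  · have h1 := X_pow_dvd_weightedSeries_sub_one h
    have h2 := X_pow_dvd_reducedSeries_sub_one h
    have h3 := X_pow_dvd_doubleSeries_sub_one h (h.trans (Nat.le_succ m))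
    have h4 := X_pow_dvd_doubleSeries_sub_one h h
    constructor
    · convert dvd_sub h1 h3 using 1
      ring
    · convert dvd_sub h2 h4 using 1
      ring

theorem rrSeries_listWeight : rrSeries 1 listWeight = weightedSeries 0 := by
  rw [rrSeries_eq_add one_pos, rrSeries_eq_add (a := 1 + 1) two_pos,
    rrSeries_congr (a := 3) (f := listWeight) fun l _ hl => listWeight_eq_fullWeight hl,
    rrSeries_congr (f := fun l => listWeight (2 :: l)) fun l _ hl => listWeight_two_cons hl,
    rrSeries_congr (f := fun l => listWeight (1 :: l)) fun l _ hl => listWeight_one_cons hl]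
  rfl

theorem sum_weight_eq_coeff (n : ℕ) :
    ((∑ p ∈ univ.filter (fun p : n.Partition => IsRogersRamanujan p), weight p : ℕ) : ℤ) =
      coeff n (rrSeries 1 listWeight) := by
  have h : rrLists 1 n =
      (univ.filter fun p : n.Partition => IsRogersRamanujan p).image sortedParts := by
    refine filter_true_of_mem fun l hl x hx => ?_
    obtain ⟨p, -, rfl⟩ := mem_image.1 hl
    exact p.parts_pos ((Multiset.mem_sort _).1 hx)
  rw [rrSeries, coeff_mk, h, sum_image fun p _ q _ hpq => sortedParts_injective n hpq, Nat.cast_sum]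
  rfl

end RRWeighted

theorem theorem6 (n : ℕ) :
    (Finset.univ.filter (fun p : n.Partition =>
        ∀ a ∈ p.parts, ¬ (a : ℤ) ≡ 0 [ZMOD 7] ∧ ¬ (a : ℤ) ≡ 2 [ZMOD 7] ∧
          ¬ (a : ℤ) ≡ -2 [ZMOD 7])).card =
      ∑ p ∈ Finset.univ.filter (fun p : n.Partition => RRWeighted.IsRogersRamanujan p),
        RRWeighted.weight p := by
  have h := congrArg (PowerSeries.coeff n) RRWeighted.mk_card_restricted_eq_doubleSeries
  rw [← RRWeighted.weightedSeries_zero, ← RRWeighted.rrSeries_listWeight,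
    ← RRWeighted.sum_weight_eq_coeff, PowerSeries.coeff_mk, Nat.cast_inj] at h
  rw [← h, Nat.Partition.restricted]
  congr 1
  refine Finset.filter_congr fun p _ => forall₂_congr fun a _ => ?_
  simp only [Int.ModEq]
  omega
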